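/- **Proposition (Relative delta-method).** Let $\mathbb{D}$ and $\mathbb{E}$ be metrizable real topological vector spaces, with $\mathbb{E}$ locally convex. Let $X_n\colon\Omega_n\to\mathbb{D}$ and $Y_n\colon\Omega_n'\to\mathbb{D}$, $n\in\mathbb{N}$, be arbitrary (not necessarily measurable) maps defined on probability spaces, let $r_n\in\mathbb{R}$ with $r_n\to\infty$, let $\mathbb{D}_0\subset\mathbb{D}$ be open, and let $\theta_n\in\mathbb{D}_0$ be relatively compact in $\mathbb{D}_0$, i.e. every subsequence of $(\theta_n)$ has a further subsequence converging to a point of $\mathbb{D}_0$. Let $\phi\colon\mathbb{D}\to\mathbb{E}$ be continuously Hadamard-differentiable in $\mathbb{D}_0$ with derivatives $\phi'_\theta$: for each $\theta\in\mathbb{D}_0$ the map $\phi'_\theta\colon\mathbb{D}\to\mathbb{E}$ is continuous and linear, $$\frac{\phi(\theta+t_nh_n)-\phi(\theta)}{t_n}\to\phi'_\theta(h)\qquad\text{whenever } 0\neq t_n\to0 \text{ in } \mathbb{R} \text{ and } h_n\to h \text{ in } \mathbb{D},$$ and $\phi'_\theta$ is continuous in $\theta\in\mathbb{D}_0$, in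 the sense that $(\theta,h)\mapsto\phi'_\theta(h)$ is continuous on $\mathbb{D}_0\times\mathbb{D}$ (equivalently, $\theta\mapsto\phi'_\theta$ is continuous for uniform convergence on compact sets). Two sequences of maps $U_n, V_n$ with values in the same space $S$ are called relatively weakly convergent, written $U_n\leftrightarrow_d V_n$, if $|\mathrm{E}^*f(U_n)-\mathrm{E}^*f(V_n)|\to0$ for all bounded continuous $f\colon S\to\mathbb{R}$, where $\mathrm{E}^*$ is outer expectation. The sequence $Y_n$ is called relatively compact if every subsequence has a further subsequence $Y_{n_k}$ for which there is a tight Borel probability measure $\nu$ on $\mathbb{D}$ with $\mathrm{E}^*f(Y_{n_k})\to\int f\,d\nu$ for all bounded continuous $f\colon\mathbb{D}\to\mathbb{R}$. If $Y_n$ is relatively compact and $$r_n(X_n-\theta_n)\leftrightarrow_d Y_n,$$ then $$r_n\bigl(\phi(X_n)-\phi(\theta_n)\bigr)\leftrightarrow_d\phi'_{\theta_n}(Y_n).$$ -/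

import Mathlib

open Filter Topology MeasureTheory
open scoped BoundedContinuousFunction

noncomputable section

namespace RelWeak

/-- Outer expectation `E^* Z` of a not necessarily measurable function `Z`: the infimum of `E U` over
the integrable measurable majorants `U` of `Z`. It is only ever applied to bounded functions `Z`; for
these, allowing extended-real majorants whose expectation exists gives the same infimum. -/
def outerExpectation {Ω : Type*} [MeasurableSpace Ω] (P : Measure Ω) (Z : Ω → ℝ) : ℝ :=
  sInf {a : ℝ | ∃ U : Ω → ℝ, Measurable U ∧ Integrable U P ∧ (∀ ω, Z ω ≤ U ω) ∧ a = ∫ ω, U ω ∂P}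

/-- `X n → ν` weakly in the sense of Hoffmann-Jørgensen, where the `X n : Ω n → S` are arbitrary maps
and `ν` is a Borel law on `S`. -/
def ConvergesWeakly {S : Type*} [TopologicalSpace S] [MeasurableSpace S]
    {Ω : ℕ → Type*} [∀ n, MeasurableSpace (Ω n)] (P : ∀ n, Measure (Ω n))
    (X : ∀ n, Ω n → S) (ν : ProbabilityMeasure S) : Prop :=
  ∀ f : S →ᵇ ℝ,
    Tendsto (fun n => outerExpectation (P n) (fun ω => f (X n ω))) atTop
      (𝓝 (∫ x, f x ∂(ν : Measure S)))

/-- Relative compactness of a sequence of arbitrary maps: every subsequence contains a further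
subsequence which converges weakly to a tight Borel law. -/
def IsRelativelyCompact {S : Type*} [TopologicalSpace S] [MeasurableSpace S]
    {Ω : ℕ → Type*} [∀ n, MeasurableSpace (Ω n)] (P : ∀ n, Measure (Ω n))
    (X : ∀ n, Ω n → S) : Prop :=
  ∀ k : ℕ → ℕ, StrictMono k → ∃ l : ℕ → ℕ, StrictMono l ∧ ∃ ν : ProbabilityMeasure S,
    IsTightMeasureSet {(ν : Measure S)} ∧
      ConvergesWeakly (fun i => P (k (l i))) (fun i => X (k (l i))) ν

/-- Relative weak convergence `X n ↔ Y n`: `|E^* f(X n) - E^* f(Y n)| → 0` for every bounded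
continuous real function `f`. -/
def RelativelyWeaklyConvergent {S : Type*} [TopologicalSpace S]
    {Ω : ℕ → Type*} [∀ n, MeasurableSpace (Ω n)] (P : ∀ n, Measure (Ω n)) (X : ∀ n, Ω n → S)
    {Ω' : ℕ → Type*} [∀ n, MeasurableSpace (Ω' n)] (P' : ∀ n, Measure (Ω' n)) (Y : ∀ n, Ω' n → S) :
    Prop :=
  ∀ f : S →ᵇ ℝ,
    Tendsto (fun n => |outerExpectation (P n) (fun ω => f (X n ω)) -
      outerExpectation (P' n) (fun ω => f (Y n ω))|) atTop (𝓝 0)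

/-- A sequence of points is relatively compact in `U`: every subsequence contains a further
subsequence which converges to a point of `U`. -/
def IsRelativelyCompactSeqIn {S : Type*} [TopologicalSpace S] (U : Set S) (θ : ℕ → S) : Prop :=
  ∀ k : ℕ → ℕ, StrictMono k → ∃ l : ℕ → ℕ, StrictMono l ∧ ∃ a ∈ U,
    Tendsto (fun i => θ (k (l i))) atTop (𝓝 a)

section Hadamard

variable {D E : Type*} [AddCommGroup D] [Module ℝ D] [TopologicalSpace D]
  [AddCommGroup E] [Module ℝ E] [TopologicalSpace E]

/-- The continuous linear map `L` is the Hadamard derivative of `φ` at `θ`. -/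
def HasHadamardDerivAt (φ : D → E) (L : D →L[ℝ] E) (θ : D) : Prop :=
  ∀ (t : ℕ → ℝ) (h : ℕ → D) (h₀ : D), (∀ n, t n ≠ 0) → Tendsto t atTop (𝓝 0) →
    Tendsto h atTop (𝓝 h₀) →
      Tendsto (fun n => (t n)⁻¹ • (φ (θ + t n • h n) - φ θ)) atTop (𝓝 (L h₀))

/-- `φ` is continuously Hadamard-differentiable in `U` with derivative `φ'`. Continuity of
`θ ↦ φ' θ` is meant in the topology of uniform convergence on compact sets; between metrizable
spaces this is the same as joint continuity of `(θ, h) ↦ φ' θ h`. -/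
def HasContinuousHadamardDerivOn (φ : D → E) (φ' : D → D →L[ℝ] E) (U : Set D) : Prop :=
  (∀ θ ∈ U, HasHadamardDerivAt φ (φ' θ) θ) ∧
    ContinuousOn (fun p : D × D => φ' p.1 p.2) (U ×ˢ Set.univ)

end Hadamard

end RelWeak

end

open Filter Topology MeasureTheory
open scoped BoundedContinuousFunction

namespace RelWeak

section OuterExpectation

/-! With Z_n = r_n(X_n - θ_n), the left side is g_n(Z_n) for g_n(z) = r_n(φ(θ_n + z/r_n) - φ(θ_n)).
Along a subsequence θ_n → a in D₀ and Y_n, hence Z_n, converges weakly to a tight ν. Both g_n and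
φ'_{θ_n} converge continuously to φ'_a: for g_n by `difference_quotient_mem`, a mean value theorem
with values in a locally convex space. The extended continuous mapping theorem then gives both sides
the limit ∫ f ∘ φ'_a dν. -/

/-- Outer expectation is monotone on bounded functions. -/
theorem outerExpectation_mono {Ω : Type*} [MeasurableSpace Ω] (P : Measure Ω)
    [IsProbabilityMeasure P] {Z Z' : Ω → ℝ} {a b : ℝ} (ha : ∀ ω, a ≤ Z ω) (hb : ∀ ω, Z' ω ≤ b)
    (h : ∀ ω, Z ω ≤ Z' ω) : outerExpectation P Z ≤ outerExpectation P Z' := by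
  refine csInf_le_csInf ⟨a, ?_⟩
    ⟨∫ _, b ∂P, fun _ => b, measurable_const, integrable_const _, hb, rfl⟩ ?_
  · rintro _ ⟨U, -, hU, hZU, rfl⟩
    simpa using integral_mono (integrable_const a) hU fun ω => (ha ω).trans (hZU ω)
  · rintro _ ⟨U, hUm, hU, hZU, rfl⟩
    exact ⟨U, hUm, hU, fun ω => (h ω).trans (hZU ω), rfl⟩

variable {S T : Type*} [TopologicalSpace S] [TopologicalSpace.MetrizableSpace S]
  [MeasurableSpace S] [BorelSpace S] [TopologicalSpace T]
  {Ω : ℕ → Type*} [∀ n, MeasurableSpace (Ω n)] {P : ∀ n, Measure (Ω n)}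
  {Z : ∀ n, Ω n → S} {ν : ProbabilityMeasure S}

/-- A bounded continuous function which dominates the indicator of the complement of an open
neighbourhood of a compact set of large mass has small integral. -/
theorem exists_cutoff_integral_le {δ : ℝ} (hδ : 0 < δ) {K G : Set S} (hK : IsCompact K)
    (hνK : (ν : Measure S) Kᶜ ≤ ENNReal.ofReal δ) (hG : IsOpen G) (hKG : K ⊆ G) :
    ∃ χ : S →ᵇ ℝ, (∀ x, 0 ≤ χ x) ∧ (∀ x ∉ G, χ x = 1) ∧ ∫ x, χ x ∂(ν : Measure S) ≤ δ := by
  let _ := TopologicalSpace.metrizableSpaceMetric S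
  obtain ⟨χ, hχK, hχG, hχ⟩ := exists_bounded_zero_one_of_closed hK.isClosed hG.isClosed_compl
    (Set.disjoint_compl_right_iff_subset.2 hKG)
  refine ⟨χ, fun x => (hχ x).1, fun x hx => hχG hx, ?_⟩
  have hKm : MeasurableSet Kᶜ := hK.isClosed.measurableSet.compl
  calc ∫ x, χ x ∂(ν : Measure S)
      ≤ ∫ x, Kᶜ.indicator (fun _ => (1 : ℝ)) x ∂(ν : Measure S) := by
        refine integral_mono (χ.integrable _) ((integrable_const _).indicator hKm) fun x => ?_
        by_cases hx : x ∈ K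
        · simp [hx, hχK hx]
        · simpa [hx] using (hχ x).2
    _ = (ν : Measure S).real Kᶜ := by simp [integral_indicator hKm]
    _ ≤ δ := ENNReal.toReal_le_of_le_ofReal hδ.le hνK

/-- If `g n → F` continuously and boundedly, and `Z n` converges weakly to a tight law `ν`, then
the outer expectations of `g n (Z n)` converge to `∫ F dν`. -/
theorem tendsto_outerExpectation_of_continuous_convergence [∀ n, IsProbabilityMeasure (P n)]
    (hν : IsTightMeasureSet {(ν : Measure S)}) (hZ : ConvergesWeakly P Z ν)
    (F : S →ᵇ ℝ) (g : ℕ → S → ℝ) {C : ℝ} (hC : ∀ n x, |g n x - F x| ≤ C)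
    (hg : ∀ x, Tendsto (fun p : S × ℕ => g p.2 p.1) (𝓝 x ×ˢ atTop) (𝓝 (F x))) :
    Tendsto (fun n => outerExpectation (P n) (fun ω => g n (Z n ω))) atTop
      (𝓝 (∫ x, F x ∂(ν : Measure S))) := by
  have hC0 : 0 ≤ C := by
    obtain ⟨x⟩ : Nonempty S := (ν : Measure S).nonempty_of_neZero
    exact (abs_nonneg _).trans (hC 0 x)
  have hF : ∀ x, |F x| ≤ ‖F‖ := fun x => F.norm_coe_le_norm x
  -- The error is below δ near a compact set of large mass and at most C elsewhere, so δ + Cχ with a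
  -- cutoff χ is a continuous majorant; no measurability of `g n` is needed.
  have key : ∀ ε > 0, ∃ χ : S →ᵇ ℝ, (∀ᶠ n in atTop, ∀ x, |g n x - F x| ≤ χ x) ∧
      ∫ x, χ x ∂(ν : Measure S) < ε := by
    intro ε hε
    -- C + 1 would give only δ + Cδ = ε.
    set δ := ε / (C + 2) with hδ_def
    have hδ : 0 < δ := by positivity
    have hδε : δ + C * δ < ε := by
      have : δ * (C + 2) = ε := by rw [hδ_def]; field_simp
      nlinarith
    obtain ⟨K, hK, hνK⟩ := isTightMeasureSet_iff_exists_isCompact_measure_compl_le.1 hν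
      (ENNReal.ofReal δ) (by simpa using hδ)
    have hmem : {p : S × ℕ | |g p.2 p.1 - F p.1| < δ} ∈ 𝓝ˢ K ×ˢ (atTop : Filter ℕ) := by
      refine hK.mem_nhdsSet_prod_of_forall fun x _ => ?_
      have h2 : Tendsto (fun p : S × ℕ => g p.2 p.1 - F p.1) (𝓝 x ×ˢ atTop) (𝓝 (F x - F x)) :=
        (hg x).sub ((F.continuous.tendsto x).comp tendsto_fst)
      rw [sub_self] at h2
      filter_upwards [h2.eventually (Metric.ball_mem_nhds 0 hδ)] with p hp
      simpa using hp
    obtain ⟨A, hA, B, hB, hAB⟩ := mem_prod_iff.1 hmem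
    obtain ⟨G, hG, hKG, hGA⟩ := mem_nhdsSet_iff_exists.1 hA
    obtain ⟨χ, hχ0, hχ1, hχ⟩ := exists_cutoff_integral_le hδ hK (hνK _ rfl) hG hKG
    refine ⟨BoundedContinuousFunction.const S δ + C • χ, ?_, ?_⟩
    · filter_upwards [hB] with n hn x
      simp only [BoundedContinuousFunction.coe_add, Pi.add_apply,
        BoundedContinuousFunction.const_apply, BoundedContinuousFunction.coe_smul, smul_eq_mul]
      by_cases hx : x ∈ G
      · have : |g n x - F x| < δ := hAB (Set.mk_mem_prod (hGA hx) hn)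
        nlinarith [mul_nonneg hC0 (hχ0 x)]
      · rw [hχ1 x hx]
        linarith [hC n x]
    · simp only [BoundedContinuousFunction.coe_add, Pi.add_apply,
        BoundedContinuousFunction.const_apply, BoundedContinuousFunction.coe_smul, smul_eq_mul]
      rw [integral_add (integrable_const _) ((χ.integrable _).const_mul C), integral_const_mul]
      simp only [integral_const, probReal_univ, one_smul]
      nlinarith [mul_le_mul_of_nonneg_left hχ hC0]
  -- Sandwich F - χ ≤ g n ≤ F + χ: weak convergence applies to both bounds.
  refine tendsto_order.2 ⟨fun a ha => ?_, fun a ha => ?_⟩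
  · obtain ⟨χ, hχ, hχi⟩ := key _ (sub_pos.2 ha)
    have hlim := hZ (F - χ)
    simp only [BoundedContinuousFunction.coe_sub, Pi.sub_apply] at hlim
    rw [integral_sub (F.integrable _) (χ.integrable _)] at hlim
    filter_upwards [hχ, (tendsto_order.1 hlim).1 a (by linarith)] with n hn hlt
    refine hlt.trans_le (outerExpectation_mono (P n) (a := -‖F - χ‖) (b := ‖F‖ + C)
      (fun ω => ?_) (fun ω => ?_) fun ω => ?_)
    · exact (abs_le.1 ((F - χ).norm_coe_le_norm (Z n ω))).1
    · linarith [(abs_le.1 (hC n (Z n ω))).2, (abs_le.1 (hF (Z n ω))).2]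
    · linarith [(abs_le.1 (hn (Z n ω))).1]
  · obtain ⟨χ, hχ, hχi⟩ := key _ (sub_pos.2 ha)
    have hlim := hZ (F + χ)
    simp only [BoundedContinuousFunction.coe_add, Pi.add_apply] at hlim
    rw [integral_add (F.integrable _) (χ.integrable _)] at hlim
    filter_upwards [hχ, (tendsto_order.1 hlim).2 a (by linarith)] with n hn hlt
    refine (outerExpectation_mono (P n) (a := -‖F‖ - C) (b := ‖F + χ‖)
      (fun ω => ?_) (fun ω => ?_) fun ω => ?_).trans_lt hlt
    · linarith [(abs_le.1 (hC n (Z n ω))).1, (abs_le.1 (hF (Z n ω))).1]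
    · exact (abs_le.1 ((F + χ).norm_coe_le_norm (Z n ω))).2
    · linarith [(abs_le.1 (hn (Z n ω))).2]

/-- Extended continuous mapping theorem for arbitrary maps and a tight limit law. -/
theorem ConvergesWeakly.tendsto_outerExpectation_comp [∀ n, IsProbabilityMeasure (P n)]
    (hν : IsTightMeasureSet {(ν : Measure S)}) (hZ : ConvergesWeakly P Z ν)
    {G : S → T} (hG : Continuous G) {g : ℕ → S → T}
    (hg : ∀ x, Tendsto (fun p : S × ℕ => g p.2 p.1) (𝓝 x ×ˢ atTop) (𝓝 (G x))) (f : T →ᵇ ℝ) :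
    Tendsto (fun n => outerExpectation (P n) (fun ω => f (g n (Z n ω)))) atTop
      (𝓝 (∫ x, f (G x) ∂(ν : Measure S))) := by
  refine tendsto_outerExpectation_of_continuous_convergence hν hZ
    (f.compContinuous ⟨G, hG⟩) (fun n x => f (g n x)) (C := 2 * ‖f‖) (fun n x => ?_) fun x => ?_
  · exact f.dist_le_two_norm _ _
  · exact (f.continuous.tendsto _).comp (hg x)

end OuterExpectation

section Hadamard

variable {D E : Type*} [AddCommGroup D] [Module ℝ D] [TopologicalSpace D]
  [AddCommGroup E] [Module ℝ E] [TopologicalSpace E]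

/-- Along every line, a Hadamard differentiable function composed with a continuous linear
functional is differentiable. -/
theorem HasHadamardDerivAt.hasDerivAt_line {φ : D → E} {L : D →L[ℝ] E} {θ z : D} {τ : ℝ}
    (h : HasHadamardDerivAt φ L (θ + τ • z)) (l : E →L[ℝ] ℝ) :
    HasDerivAt (fun s : ℝ => l (φ (θ + s • z))) (l (L z)) τ := by
  rw [hasDerivAt_iff_tendsto_slope_zero]
  refine tendsto_of_seq_tendsto fun t ht => ?_
  obtain ⟨ht0, hne⟩ := tendsto_nhdsWithin_iff.1 ht
  -- The Hadamard condition wants every `t n` nonzero, hence the shift by N.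
  obtain ⟨N, hN⟩ := eventually_atTop.1 hne
  rw [← tendsto_add_atTop_iff_nat N]
  have := h (fun n => t (n + N)) (fun _ => z) z (fun n => hN _ (Nat.le_add_left _ _))
    ((tendsto_add_atTop_iff_nat N).2 ht0) tendsto_const_nhds
  refine ((l.continuous.tendsto _).comp this).congr fun n => ?_
  simp [add_smul, add_assoc]

variable [IsTopologicalAddGroup E] [ContinuousSMul ℝ E]

/-- If all derivatives along a segment lie in an open convex set, so does the difference
quotient. -/
theorem difference_quotient_mem {φ : D → E} {φ' : D → D →L[ℝ] E} {θ z : D} {t : ℝ} (ht : 0 < t)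
    {C : Set E} (hC : Convex ℝ C) (hCo : IsOpen C)
    (hφ : ∀ τ ∈ Set.Icc 0 t, HasHadamardDerivAt φ (φ' (θ + τ • z)) (θ + τ • z))
    (hmem : ∀ τ ∈ Set.Icc 0 t, φ' (θ + τ • z) z ∈ C) :
    t⁻¹ • (φ (θ + t • z) - φ θ) ∈ C := by
  -- A functional separating the quotient from C contradicts the scalar mean value theorem on the
  -- segment.
  by_contra hx
  obtain ⟨l, hl⟩ := geometric_hahn_banach_open_point hC hCo hx
  have hd := fun τ hτ => (hφ τ hτ).hasDerivAt_line l
  obtain ⟨c, hc, hceq⟩ := exists_hasDerivAt_eq_slope (fun s : ℝ => l (φ (θ + s • z)))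
    (fun τ => l (φ' (θ + τ • z) z)) ht (fun τ hτ => (hd τ hτ).continuousAt.continuousWithinAt)
    fun τ hτ => hd τ (Set.Ioo_subset_Icc_self hτ)
  refine (hl _ (hmem c (Set.Ioo_subset_Icc_self hc))).ne ?_
  rw [hceq]
  simp [div_eq_inv_mul]

variable [IsTopologicalAddGroup D] [ContinuousSMul ℝ D] [LocallyConvexSpace ℝ E]

/-- The difference quotients of a continuously Hadamard differentiable function converge to the
derivative locally uniformly in the base point and the direction. -/
theorem HasContinuousHadamardDerivOn.tendsto_difference_quotient {φ : D → E}
    {φ' : D → D →L[ℝ] E} {U : Set D} (hU : IsOpen U) (h : HasContinuousHadamardDerivOn φ φ' U)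
    {θ : D} (hθ : θ ∈ U) (z : D) :
    Tendsto (fun p : ℝ × D × D => p.1⁻¹ • (φ (p.2.1 + p.1 • p.2.2) - φ p.2.1))
      (𝓝[>] 0 ×ˢ 𝓝 (θ, z)) (𝓝 (φ' θ z)) := by
  refine tendsto_def.2 fun V hV => ?_
  obtain ⟨C, ⟨hCmem, hCo, hC⟩, hCV⟩ : ∃ C : Set E, (φ' θ z ∈ C ∧ IsOpen C ∧ Convex ℝ C) ∧ C ⊆ V := by
    obtain ⟨W, ⟨hW, hWc⟩, hWV⟩ :=
      (LocallyConvexSpace.convex_basis (𝕜 := ℝ) (φ' θ z)).mem_iff.1 hV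
    exact ⟨interior W, ⟨mem_interior_iff_mem_nhds.2 hW, isOpen_interior, hWc.interior⟩,
      interior_subset.trans hWV⟩
  have hline : Tendsto (fun p : ℝ × D × D => (p.2.1 + p.1 • p.2.2, p.2.2)) (𝓝 (0, θ, z))
      (𝓝 (θ, z)) := by
    have : Continuous fun p : ℝ × D × D => (p.2.1 + p.1 • p.2.2, p.2.2) := by fun_prop
    simpa using this.tendsto (0, θ, z)
  have hnhds : U ×ˢ (Set.univ : Set D) ∈ 𝓝 (θ, z) :=
    prod_mem_nhds (hU.mem_nhds hθ) univ_mem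
  have hgood : ∀ᶠ q : D × D in 𝓝 (θ, z), q.1 ∈ U ∧ φ' q.1 q.2 ∈ C :=
    (eventually_of_mem hnhds fun q hq => hq.1).and
      ((h.2.continuousAt hnhds).eventually (hCo.mem_nhds hCmem))
  have hev := hline.eventually hgood
  rw [nhds_prod_eq] at hev
  -- The product form makes one neighbourhood of (θ, z) serve all τ ∈ [0, t] at once.
  obtain ⟨pa, hpa, pb, hpb, hp⟩ := eventually_prod_iff.1 hev
  obtain ⟨δ, hδ, hball⟩ := Metric.eventually_nhds_iff.1 hpa
  have hsmall : ∀ᶠ t : ℝ in 𝓝[>] 0, t ∈ Set.Ioo 0 δ := Ioo_mem_nhdsGT hδ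
  filter_upwards [hsmall.prod_mk hpb] with ⟨t, θ', z'⟩ ⟨ht, hq⟩
  have hτ : ∀ τ ∈ Set.Icc 0 t, θ' + τ • z' ∈ U ∧ φ' (θ' + τ • z') z' ∈ C := fun τ hτ =>
    hp (hball (by
      rw [Real.dist_eq, sub_zero, abs_of_nonneg hτ.1]
      exact hτ.2.trans_lt ht.2)) hq
  exact hCV (difference_quotient_mem ht.1 hC hCo (fun τ h' => h.1 _ (hτ τ h').1)
    fun τ h' => (hτ τ h').2)

end Hadamard

end RelWeak

theorem mainTheorem10
    {D E : Type*}
    [AddCommGroup D] [Module ℝ D] [TopologicalSpace D] [IsTopologicalAddGroup D]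
    [ContinuousSMul ℝ D] [TopologicalSpace.MetrizableSpace D] [MeasurableSpace D] [BorelSpace D]
    [AddCommGroup E] [Module ℝ E] [TopologicalSpace E] [IsTopologicalAddGroup E]
    [ContinuousSMul ℝ E] [TopologicalSpace.MetrizableSpace E] [LocallyConvexSpace ℝ E]
    {Ω : ℕ → Type*} [∀ n, MeasurableSpace (Ω n)]
    (P : ∀ n, Measure (Ω n)) [∀ n, IsProbabilityMeasure (P n)]
    {Ω' : ℕ → Type*} [∀ n, MeasurableSpace (Ω' n)]
    (P' : ∀ n, Measure (Ω' n)) [∀ n, IsProbabilityMeasure (P' n)]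
    (D₀ : Set D) (hD₀ : IsOpen D₀)
    (φ : D → E) (φ' : D → D →L[ℝ] E)
    (hφ : RelWeak.HasContinuousHadamardDerivOn φ φ' D₀)
    (θ : ℕ → D) (hθ_mem : ∀ n, θ n ∈ D₀) (hθ : RelWeak.IsRelativelyCompactSeqIn D₀ θ)
    (r : ℕ → ℝ) (hr : Tendsto r atTop atTop)
    (X : ∀ n, Ω n → D) (Y : ∀ n, Ω' n → D)
    (hY : RelWeak.IsRelativelyCompact P' Y)
    (hXY : RelWeak.RelativelyWeaklyConvergent P (fun n ω => r n • (X n ω - θ n)) P' Y) :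
    RelWeak.RelativelyWeaklyConvergent
      P (fun n ω => r n • (φ (X n ω) - φ (θ n)))
      P' (fun n ω => φ' (θ n) (Y n ω)) := by
  intro f
  refine tendsto_of_subseq_tendsto fun ns hns => ?_
  -- `ns` merely tends to infinity, while relative compactness speaks of strictly increasing
  -- subsequences.
  obtain ⟨k, -, hk⟩ := strictMono_subseq_of_tendsto_atTop hns
  obtain ⟨l, hl, a, ha, hθa⟩ := hθ _ hk
  obtain ⟨m, hm, ν, hν, hYν⟩ := hY _ (hk.comp hl)
  let j : ℕ → ℕ := fun i => ns (k (l (m i)))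
  have hj : Tendsto j atTop atTop := ((hk.comp hl).comp hm).tendsto_atTop
  have hθj : Tendsto (fun i => θ (j i)) atTop (𝓝 a) := hθa.comp hm.tendsto_atTop
  have hrj : Tendsto (fun i => r (j i)) atTop atTop := hr.comp hj
  have hYj : RelWeak.ConvergesWeakly (fun i => P' (j i)) (fun i => Y (j i)) ν := hYν
  have hZj : RelWeak.ConvergesWeakly (fun i => P (j i))
      (fun i ω => r (j i) • (X (j i) ω - θ (j i))) ν := fun u => by
    simpa using ((tendsto_zero_iff_abs_tendsto_zero _).2 ((hXY u).comp hj)).add (hYj u)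
  have hpair : ∀ x : D, Tendsto (fun p : D × ℕ => (θ (j p.2), p.1)) (𝓝 x ×ˢ atTop)
      (𝓝 (a, x)) := fun x => (hθj.comp tendsto_snd).prodMk_nhds tendsto_fst
  have h1 := hZj.tendsto_outerExpectation_comp hν (φ' a).continuous
    (g := fun i z => (r (j i))⁻¹⁻¹ • (φ (θ (j i) + (r (j i))⁻¹ • z) - φ (θ (j i))))
    (fun x => (hφ.tendsto_difference_quotient hD₀ ha x).comp
      (((tendsto_inv_atTop_nhdsGT_zero.comp hrj).comp tendsto_snd).prodMk (hpair x))) f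
  have h2 := hYj.tendsto_outerExpectation_comp hν (φ' a).continuous
    (g := fun i y => φ' (θ (j i)) y)
    (fun x => (hφ.2.continuousAt
      (prod_mem_nhds (hD₀.mem_nhds ha) univ_mem)).tendsto.comp (hpair x)) f
  refine ⟨fun i => k (l (m i)), ?_⟩
  have h3 := (h1.sub h2).abs
  rw [sub_self, abs_zero] at h3
  refine h3.congr' ?_
  -- Recovering X from Z needs r ≠ 0, which holds only eventually.
  filter_upwards [hrj.eventually_gt_atTop 0] with i hi
  simp only [inv_smul_smul₀ hi.ne', inv_inv, add_sub_cancel, j]
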